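/- Let $d\ge 2$ be an integer and let $\mathbb T^d=(\mathbb R/\mathbb Z)^d$. For $M\in M_d(\mathbb Z)$ with $\det M\neq 0$, let $T_M:\mathbb T^d\to\mathbb T^d$ be the map $x\mapsto Mx \bmod 1$, and for a Borel probability measure $\mu$ on $\mathbb T^d$ let $T_M\mu$ be the image measure, $T_M\mu(C)=\mu(T_M^{-1}C)$ for every Borel set $C\subseteq\mathbb T^d$. Let $\mathcal P_M(\mathbb T^d)$ be the set of Borel probability measures $\mu$ on $\mathbb T^d$ with $T_M\mu=\mu$, endowed with the topology of weak* convergence, and let $\mathrm{Leb}_d$ be the normalised Lebesgue measure on $\mathbb T^d$. A measure is called continuous if every one-point set has measure zero. Let $A,B\in M_d(\mathbb Z)$ with $\det A\neq 0$ and $\det B\neq 0$. Suppose that (a) $A$ is similar over $\mathbb C$ to a diagonal matrix $\mathrm{diag}(\lambda_1,\dots,\lambda_d)$ with $|\lambda_j|\neq 1$ for all $1\le j\le d$; and that at least one of the following holds: (b) $\gcd(\det A,\det B)=1$; (b') $A$ is upper triangular or lower triangular. Then the set $$\bigl\{\mu\in\mathcal P_A(\mathbb T^d)\;:\;\mu \text{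 is continuous and } T_{B^n}\mu \text{ does not converge weak* to } \mathrm{Leb}_d \text{ as } n\to+\infty\bigr\}$$ is residual in $\mathcal P_A(\mathbb T^d)$, i.e. it contains a countable intersection of dense open subsets of $\mathcal P_A(\mathbb T^d)$ (equivalently, since this space is compact and metrizable, a dense $G_\delta$ subset). -/

import Mathlib

open MeasureTheory Filter Topology

namespace ToralDynamics

/-- The endomorphism `x ↦ A x mod 1` of the torus `𝕋^d = (ℝ/ℤ)^d` given by an integer matrix `A`. -/
def toralMap {d : ℕ} (A : Matrix (Fin d) (Fin d) ℤ) (x : UnitAddTorus (Fin d)) :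
    UnitAddTorus (Fin d) :=
  fun i => ∑ j, A i j • x j

theorem continuous_toralMap {d : ℕ} (A : Matrix (Fin d) (Fin d) ℤ) :
    Continuous (toralMap A) :=
  continuous_pi fun i => continuous_finsetSum _ fun j _ => (continuous_apply j).zsmul (A i j)

/-- The image (push-forward) of a Borel probability measure on the torus under `T_A`. -/
noncomputable def pushforward {d : ℕ} (A : Matrix (Fin d) (Fin d) ℤ)
    (μ : ProbabilityMeasure (UnitAddTorus (Fin d))) :
    ProbabilityMeasure (UnitAddTorus (Fin d)) :=
  μ.map (continuous_toralMap A).measurable.aemeasurable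

/-- The set of `T_A`-invariant Borel probability measures on the torus; as a subtype of
`ProbabilityMeasure` it carries the topology of weak-* convergence. -/
def invariantMeasures {d : ℕ} (A : Matrix (Fin d) (Fin d) ℤ) :
    Set (ProbabilityMeasure (UnitAddTorus (Fin d))) :=
  {μ | pushforward A μ = μ}

theorem isProbabilityMeasure_volume (d : ℕ) :
    IsProbabilityMeasure (volume : Measure (UnitAddTorus (Fin d))) :=
  ⟨by simp [volume_pi, Measure.pi_univ]⟩

/-- The normalised Lebesgue measure on the torus. -/
noncomputable def lebesgue (d : ℕ) : ProbabilityMeasure (UnitAddTorus (Fin d)) :=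
  ⟨volume, isProbabilityMeasure_volume d⟩

end ToralDynamics

/-!
Points of an `A`-invariant measure `μ` are shadowed by points `y` with `A ^ n y = y`: round
`(A ^ n - 1) x` to a lattice point and solve for `y`. Since no eigenvalue of `A` lies on the unit
circle, the total length of an orbit segment is bounded by the distance between its endpoints, so
the errors along the orbit have a sum bounded independently of `n` and average out. Reducing modulo
a suitable integer, there are infinitely many `n` with `det (A ^ n - 1) = a * m`, where
`a = det (A - 1)` is fixed and `m` is coprime to `det B`; rounding to `a ℤ ^ d` makes `y` an
`m`-torsion point. Translating inside this lattice gives `K` different shadows of each point, so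
the resulting invariant measures have atoms of mass at most `1 / K`, and they are dense.

As `B` permutes the `m`-torsion, infinitely many powers of `B` fix such a measure. By Baire
category a generic invariant `μ` therefore has no atoms, differs from Lebesgue measure, and is a
cluster point of the measures `T_{B ^ n} μ`, which then cannot converge to Lebesgue measure.
-/

namespace ToralDynamics

open Matrix Polynomial
open Finset (range)
open scoped ENNReal NNReal

section OrbitLength

variable {𝕜 V : Type*} [NormedAddCommGroup V]

theorem abs_norm_sub_one_mul_sum_norm_le [NormedField 𝕜] [NormedSpace 𝕜 V] (z : 𝕜) (u : ℕ → V)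
    (n : ℕ) :
    |‖z‖ - 1| * ∑ l ∈ range n, ‖u l‖ ≤
      ‖u n - u 0‖ + ∑ l ∈ range n, ‖u (l + 1) - z • u l‖ := by
  have hshift : (‖z‖ - 1) * ∑ l ∈ range n, ‖u l‖ =
      (‖u n‖ - ‖u 0‖) - ∑ l ∈ range n, (‖u (l + 1)‖ - ‖z • u l‖) := by
    rw [Finset.sum_sub_distrib, ← Finset.sum_range_sub (fun l => ‖u l‖) n, Finset.sum_sub_distrib]
    simp only [norm_smul, ← Finset.mul_sum]
    ring
  calc |‖z‖ - 1| * ∑ l ∈ range n, ‖u l‖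
      = |(‖u n‖ - ‖u 0‖) - ∑ l ∈ range n, (‖u (l + 1)‖ - ‖z • u l‖)| := by
        rw [← hshift, abs_mul, abs_of_nonneg (Finset.sum_nonneg fun l _ => norm_nonneg (u l))]
    _ ≤ |‖u n‖ - ‖u 0‖| + ∑ l ∈ range n, |‖u (l + 1)‖ - ‖z • u l‖| :=
        (abs_sub _ _).trans (by gcongr; exact Finset.abs_sum_le_sum_abs _ _)
    _ ≤ ‖u n - u 0‖ + ∑ l ∈ range n, ‖u (l + 1) - z • u l‖ := by
        gcongr <;> exact abs_norm_sub_norm_le _ _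

theorem exists_sum_norm_pow_apply_le_of_forall_norm_ne_one [NontriviallyNormedField 𝕜]
    [NormedSpace 𝕜 V] (f : V →L[𝕜] V) (s : Multiset 𝕜) (hs : ∀ z ∈ s, ‖z‖ ≠ 1) :
    ∃ C, 0 ≤ C ∧ ∀ n v, ∑ l ∈ range n, ‖(f ^ l) v‖ ≤
      C * (‖(f ^ n) v - v‖ +
        ∑ l ∈ range n, ‖(f ^ l) (aeval f (s.map fun z => X - Polynomial.C z).prod v)‖) := by
  induction s using Multiset.induction_on with
  | empty => exact ⟨1, zero_le_one, fun n v => by simp⟩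
  | cons z s ih =>
    obtain ⟨C, hC, ih⟩ := ih fun w hw => hs w (Multiset.mem_cons_of_mem hw)
    set g : V →L[𝕜] V := f - algebraMap 𝕜 (V →L[𝕜] V) z with hg
    have hcomm : Commute f g := (Commute.refl f).sub_right (Algebra.commutes z f).symm
    set c := |‖z‖ - 1|⁻¹ with hc
    have hc_pos : 0 < |‖z‖ - 1| := abs_pos.2 (sub_ne_zero.2 (hs z (Multiset.mem_cons_self z s)))
    refine ⟨c * (1 + C * (1 + ‖g‖)), by positivity, fun n v => ?_⟩
    set S := ∑ l ∈ range n,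
      ‖(f ^ l) (aeval f ((z ::ₘ s).map fun z => X - Polynomial.C z).prod v)‖ with hS
    have hstep : ∑ l ∈ range n, ‖(f ^ l) v‖ ≤
        c * (‖(f ^ n) v - v‖ + ∑ l ∈ range n, ‖(f ^ l) (g v)‖) := by
      rw [hc, ← div_eq_inv_mul, le_div_iff₀' hc_pos]
      refine (abs_norm_sub_one_mul_sum_norm_le z (fun l => (f ^ l) v) n).trans_eq ?_
      simp only [hg, pow_succ, pow_zero, mul_apply_eq_comp,
        one_apply_eq_self, _root_.sub_apply, map_sub,
        ContinuousLinearMap.algebraMap_apply, map_smul]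
    have hrec : ∑ l ∈ range n, ‖(f ^ l) (g v)‖ ≤ C * (‖g‖ * ‖(f ^ n) v - v‖ + S) := by
      refine (ih n (g v)).trans ?_
      gcongr
      · rw [← mul_apply_eq_comp, (hcomm.pow_left n).eq, mul_apply_eq_comp,
          ← map_sub]
        exact g.le_opNorm _
      · simp [hS, hg, mul_comm (X - Polynomial.C z)]
    have : 0 ≤ S := Finset.sum_nonneg fun l _ => norm_nonneg _
    calc ∑ l ∈ range n, ‖(f ^ l) v‖
        ≤ c * (‖(f ^ n) v - v‖ + C * (‖g‖ * ‖(f ^ n) v - v‖ + S)) := by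
          grw [hstep, hrec]
      _ = c * ((1 + C * ‖g‖) * ‖(f ^ n) v - v‖ + C * S) := by ring
      _ ≤ c * ((1 + C * (1 + ‖g‖)) * ‖(f ^ n) v - v‖ + (1 + C * (1 + ‖g‖)) * S) := by
          gcongr
          · linarith
          · nlinarith [norm_nonneg g]
      _ = c * (1 + C * (1 + ‖g‖)) * (‖(f ^ n) v - v‖ + S) := by ring

theorem exists_sum_norm_pow_mulVec_le {ι : Type*} [Fintype ι] [DecidableEq ι] (M : Matrix ι ι ℂ)
    (hM : ∀ z ∈ spectrum ℂ M, ‖z‖ ≠ 1) :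
    ∃ C, 0 ≤ C ∧ ∀ n v, ∑ l ∈ range n, ‖M ^ l *ᵥ v‖ ≤ C * ‖(M ^ n - 1) *ᵥ v‖ := by
  let φ : Matrix ι ι ℂ ≃ₐ[ℂ] (ι → ℂ) →L[ℂ] (ι → ℂ) :=
    toLinAlgEquiv'.trans (Module.End.toContinuousLinearMap (ι → ℂ))
  have hφ (N : Matrix ι ι ℂ) (v : ι → ℂ) : φ N v = N *ᵥ v := rfl
  have hroots : (M.charpoly.roots.map fun z => X - Polynomial.C z).prod = M.charpoly :=
    ((IsAlgClosed.splits M.charpoly).eq_prod_roots_of_monic M.charpoly_monic).symm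
  obtain ⟨C, hC, h⟩ := exists_sum_norm_pow_apply_le_of_forall_norm_ne_one (φ M) M.charpoly.roots
    fun z hz => hM z (Matrix.mem_spectrum_of_isRoot_charpoly (isRoot_of_mem_roots hz))
  refine ⟨C, hC, fun n v => ?_⟩
  simpa only [hroots, aeval_algHom_apply, ← map_pow, hφ, aeval_self_charpoly, map_zero,
    _root_.zero_apply, mulVec_zero, norm_zero, Finset.sum_const_zero, add_zero, sub_mulVec,
    one_mulVec] using h n v

theorem exists_sum_norm_pow_mulVec_le_of_real {ι : Type*} [Fintype ι] [DecidableEq ι]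
    (M : Matrix ι ι ℝ) (hM : ∀ z ∈ spectrum ℂ (Complex.ofRealHom.mapMatrix M), ‖z‖ ≠ 1) :
    ∃ C, 0 ≤ C ∧ ∀ n v, ∑ l ∈ range n, ‖M ^ l *ᵥ v‖ ≤ C * ‖(M ^ n - 1) *ᵥ v‖ := by
  obtain ⟨C, hC, h⟩ := exists_sum_norm_pow_mulVec_le _ hM
  have hnorm (N : Matrix ι ι ℝ) (v : ι → ℝ) :
      ‖Complex.ofRealHom.mapMatrix N *ᵥ (Complex.ofReal ∘ v)‖ = ‖N *ᵥ v‖ := by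
    have hcoe : Complex.ofRealHom.mapMatrix N *ᵥ (Complex.ofReal ∘ v) = Complex.ofReal ∘ (N *ᵥ v) :=
      funext fun i => (Complex.ofRealHom.map_mulVec N v i).symm
    simp only [hcoe, Pi.norm_def, Function.comp_apply, Complex.nnnorm_real]
  refine ⟨C, hC, fun n v => ?_⟩
  simpa only [← hnorm, map_sub, map_pow, map_one] using h n (Complex.ofReal ∘ v)

end OrbitLength

section Covering

variable {d : ℕ}

/-- The action of integer matrices on the torus `𝕋^d`, as a ring homomorphism whose value at `A` is
`toralMap A`. -/
def toralEnd : Matrix (Fin d) (Fin d) ℤ →+* AddMonoid.End (UnitAddTorus (Fin d)) where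
  toFun A := AddMonoidHom.mk' (toralMap A) fun x y =>
    funext fun i => by simp [toralMap, Finset.sum_add_distrib]
  map_zero' := AddMonoidHom.ext fun x => funext fun i => by
    change toralMap 0 x i = 0
    simp [toralMap]
  map_one' := AddMonoidHom.ext fun x => funext fun i => by
    change toralMap 1 x i = x i
    simp [toralMap, one_apply, ite_smul]
  map_add' A B := AddMonoidHom.ext fun x => funext fun i => by
    change toralMap (A + B) x i = toralMap A x i + toralMap B x i
    simp [toralMap, add_smul, Finset.sum_add_distrib]
  map_mul' A B := AddMonoidHom.ext fun x => funext fun i => by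
    change toralMap (A * B) x i = toralMap A (toralMap B x) i
    simpa [toralMap, mul_apply, Finset.sum_smul, Finset.smul_sum, mul_smul] using Finset.sum_comm

@[simp]
theorem toralEnd_apply (A : Matrix (Fin d) (Fin d) ℤ) (x : UnitAddTorus (Fin d)) :
    toralEnd A x = toralMap A x := rfl

theorem toralMap_pow (A : Matrix (Fin d) (Fin d) ℤ) (n : ℕ) :
    toralMap (A ^ n) = (toralMap A)^[n] := by
  ext1 x
  rw [← toralEnd_apply, map_pow, AddMonoid.End.coe_pow]
  rfl

theorem toralMap_sub_one (A : Matrix (Fin d) (Fin d) ℤ) (x : UnitAddTorus (Fin d)) :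
    toralMap (A - 1) x = toralMap A x - x := by
  rw [← toralEnd_apply, map_sub, map_one]
  rfl

/-- The linear endomorphism of `ℝ^d` covering `toralMap A`. -/
def lift : Matrix (Fin d) (Fin d) ℤ →+* Module.End ℝ (Fin d → ℝ) :=
  (toLinAlgEquiv' : _ ≃ₐ[ℝ] _).toRingEquiv.toRingHom.comp (Int.castRingHom ℝ).mapMatrix

theorem lift_apply (A : Matrix (Fin d) (Fin d) ℤ) (v : Fin d → ℝ) :
    lift A v = A.map (Int.cast : ℤ → ℝ) *ᵥ v := rfl

theorem lift_intCast (A : Matrix (Fin d) (Fin d) ℤ) (z : Fin d → ℤ) :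
    lift A (Int.cast ∘ z) = Int.cast ∘ (A *ᵥ z) :=
  funext fun i => ((Int.castRingHom ℝ).map_mulVec A z i).symm

/-- The covering homomorphism `ℝ^d → 𝕋^d`. -/
def proj : (Fin d → ℝ) →+ UnitAddTorus (Fin d) where
  toFun v i := (v i : UnitAddCircle)
  map_zero' := rfl
  map_add' _ _ := rfl

theorem proj_eq_zero_iff {v : Fin d → ℝ} : proj v = 0 ↔ ∃ z : Fin d → ℤ, Int.cast ∘ z = v := by
  have hcoord (i : Fin d) : (v i : UnitAddCircle) = 0 ↔ ∃ n : ℤ, (n : ℝ) = v i := by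
    simpa using AddCircle.coe_eq_zero_iff (1 : ℝ) (x := v i)
  simp only [funext_iff, Function.comp_apply]
  exact (forall_congr' hcoord).trans Classical.skolem

theorem dist_proj_le (v w : Fin d → ℝ) : dist (proj v) (proj w) ≤ ‖v - w‖ := by
  refine (dist_pi_le_iff (norm_nonneg _)).2 fun i => le_trans ?_ (norm_le_pi_norm (v - w) i)
  rw [dist_eq_norm]
  exact QuotientAddGroup.norm_mk_le_norm

theorem toralMap_proj (A : Matrix (Fin d) (Fin d) ℤ) (v : Fin d → ℝ) :
    toralMap A (proj v) = proj (lift A v) := by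
  ext i
  have hmk := map_sum (QuotientAddGroup.mk' (AddSubgroup.zmultiples (1 : ℝ)))
    (fun j => (A i j : ℝ) * v j) Finset.univ
  refine (Finset.sum_congr rfl fun j _ => ?_).trans hmk.symm
  rw [← zsmul_eq_mul, map_zsmul]
  rfl

/-- The Borel section of `proj` with values in `[0, 1)^d`. -/
noncomputable def fundamentalLift (x : UnitAddTorus (Fin d)) : Fin d → ℝ :=
  fun i => AddCircle.measurableEquivIco 1 0 (x i)

theorem measurable_fundamentalLift : Measurable (fundamentalLift (d := d)) :=
  measurable_pi_lambda _ fun i => measurable_subtype_coe.comp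
    ((AddCircle.measurableEquivIco (1 : ℝ) 0).measurable.comp (measurable_pi_apply i))

@[simp]
theorem proj_fundamentalLift (x : UnitAddTorus (Fin d)) : proj (fundamentalLift x) = x :=
  funext fun i => (AddCircle.measurableEquivIco (1 : ℝ) 0).symm_apply_apply (x i)

end Covering

section Arithmetic

theorem exists_isIdempotentElem_pow {M : Type*} [Monoid M] [Finite M] (x : M) :
    ∃ n, n ≠ 0 ∧ IsIdempotentElem (x ^ n) := by
  let _ : TopologicalSpace M := ⊥
  have : DiscreteTopology M := ⟨rfl⟩
  obtain ⟨_, ⟨n, hn, rfl⟩, hidem⟩ := exists_idempotent_in_compact_subsemigroup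
    (fun _ => continuous_of_discreteTopology) {y : M | ∃ n ≠ 0, x ^ n = y}
    ⟨x, 1, one_ne_zero, pow_one x⟩ (Set.toFinite _).isCompact (by
      rintro _ ⟨m, hm, rfl⟩ _ ⟨n, -, rfl⟩
      exact ⟨m + n, by omega, pow_add x m n⟩)
  exact ⟨n, hn, hidem⟩

section

variable {R : Type*} [CommRing R] {ι : Type*} [Fintype ι] [DecidableEq ι]

theorem associated_det_pow_sub_one {A : Matrix ι ι R} {T : ℕ} (hT : T ≠ 0)
    (hE : IsIdempotentElem (A ^ T)) {t : ℕ} (ht : t ≠ 0) :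
    Associated (A ^ (1 + t * T) - 1).det (A - 1).det := by
  set E := A ^ T with hE_def
  have hcomm : Commute E A := Commute.pow_self A T
  have hpow : A ^ (1 + t * T) = A * E := by
    rw [pow_add, pow_one, mul_comm t, pow_mul, hE.pow_eq ht]
  have hnil : IsNilpotent ((1 - E) * A) := by
    refine ⟨T, ?_⟩
    rw [((Commute.one_left A).sub_left hcomm).mul_pow, hE.one_sub.pow_eq hT, ← hE_def,
      hE.one_sub_mul_self]
  have hfactor : (A * E - 1) * (1 - (1 - E) * A) = A - 1 := by
    have : A * E * (A * E) = A * (A * E) := by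
      rw [hcomm.mul_mul_mul_comm, hE.eq, mul_assoc]
    simp only [sub_mul, mul_sub, one_mul, mul_one, mul_assoc A E A, hcomm.eq, this]
    abel
  obtain ⟨u, hu⟩ := (Matrix.isUnit_iff_isUnit_det _).1 hnil.isUnit_one_sub
  exact ⟨u, by rw [hu, hpow, ← det_mul, hfactor]⟩

end

theorem exists_isCoprime_mul_eq {a b q : ℤ}
    (h : Associated (a : ZMod (a * q).natAbs) (b : ZMod (a * q).natAbs)) :
    ∃ m, IsCoprime m q ∧ b = a * m := by
  obtain ⟨u, hu⟩ := h
  obtain ⟨m, hm⟩ := ZMod.intCast_surjective (u : ZMod (a * q).natAbs)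
  have hm_coprime : IsCoprime (a * q) m := by
    have := (ZMod.coe_int_isUnit_iff_isCoprime m (a * q).natAbs).1 (hm ▸ u.isUnit)
    rwa [Int.natCast_natAbs, IsCoprime.abs_left_iff] at this
  rw [← hm, ← Int.cast_mul, ZMod.intCast_eq_intCast_iff_dvd_sub] at hu
  obtain ⟨k, hk⟩ := Int.natAbs_dvd.1 hu
  exact ⟨m + q * k, hm_coprime.symm.of_mul_right_right.add_mul_left_left k,
    by linear_combination hk⟩

theorem frequently_det_pow_sub_one_eq_mul {ι : Type*} [Fintype ι] [DecidableEq ι]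
    {A : Matrix ι ι ℤ} (hA : (A - 1).det ≠ 0) {q : ℤ} (hq : q ≠ 0) :
    ∃ᶠ n in atTop, ∃ m, IsCoprime m q ∧ (A ^ n - 1).det = (A - 1).det * m := by
  have : NeZero ((A - 1).det * q).natAbs := ⟨by simp [hA, hq]⟩
  let f := Int.castRingHom (ZMod ((A - 1).det * q).natAbs)
  obtain ⟨T, hT, hE⟩ := exists_isIdempotentElem_pow (f.mapMatrix A)
  have hprog (t : ℕ) (ht : t ≠ 0) :
      ∃ m, IsCoprime m q ∧ (A ^ (1 + t * T) - 1).det = (A - 1).det * m := by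
    refine exists_isCoprime_mul_eq ?_
    have hassoc := (associated_det_pow_sub_one hT hE ht).symm
    rwa [← map_pow, ← map_one f.mapMatrix, ← map_sub, ← map_sub, ← f.map_det, ← f.map_det]
      at hassoc
  refine frequently_atTop.2 fun N => ⟨1 + (N + 1) * T, ?_, hprog (N + 1) N.succ_ne_zero⟩
  nlinarith [Nat.pos_of_ne_zero hT]

theorem exists_pow_eq_one_add_zsmul {ι : Type*} [Fintype ι] [DecidableEq ι] {B : Matrix ι ι ℤ}
    {m : ℤ} (hm : m ≠ 0) (hB : IsCoprime m B.det) :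
    ∃ r, r ≠ 0 ∧ ∀ t, ∃ D : Matrix ι ι ℤ, B ^ (r * t) = 1 + m • D := by
  have : NeZero m.natAbs := ⟨Int.natAbs_ne_zero.2 hm⟩
  let f := Int.castRingHom (ZMod m.natAbs)
  have hunit : IsUnit (f.mapMatrix B) := by
    rw [Matrix.isUnit_iff_isUnit_det, ← f.map_det]
    exact (ZMod.coe_int_isUnit_iff_isCoprime _ _).2 <| by
      rwa [Int.natCast_natAbs, IsCoprime.abs_left_iff]
  obtain ⟨r, hr, hpow⟩ := isOfFinOrder_iff_pow_eq_one.1 hunit.isOfFinOrder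
  refine ⟨r, hr.ne', fun t => ?_⟩
  have hdvd (i j : ι) : m ∣ (B ^ (r * t) - 1) i j := by
    have hzero : f.mapMatrix (B ^ (r * t) - 1) = 0 := by
      rw [map_sub, map_pow, map_one, pow_mul, hpow, one_pow, sub_self]
    exact Int.natAbs_dvd.1 ((ZMod.intCast_zmod_eq_zero_iff_dvd _ _).1 (congrFun₂ hzero i j))
  choose D hD using hdvd
  refine ⟨of D, ?_⟩
  rw [← sub_eq_iff_eq_add']
  ext i j
  simpa using hD i j

end Arithmetic

section Shadowing

variable {d : ℕ}

/-- The total length of every orbit segment of the linear map covering `toralMap A` is at most `C`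
times the distance between its endpoints. This is how the hyperbolicity of `A` enters the
shadowing argument. -/
structure OrbitLengthBound (A : Matrix (Fin d) (Fin d) ℤ) (C : ℝ) : Prop where
  nonneg : 0 ≤ C
  sum_le : ∀ n v, ∑ l ∈ range n, ‖lift (A ^ l) v‖ ≤ C * ‖lift (A ^ n - 1) v‖

theorem exists_orbitLengthBound {A : Matrix (Fin d) (Fin d) ℤ}
    (hA : ∀ z ∈ spectrum ℂ (A.map (Int.cast : ℤ → ℂ)), ‖z‖ ≠ 1) : ∃ C, OrbitLengthBound A C := by
  have hcast : Complex.ofRealHom.mapMatrix (A.map (Int.cast : ℤ → ℝ)) = A.map Int.cast := by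
    ext i j
    simp
  obtain ⟨C, hC, h⟩ := exists_sum_norm_pow_mulVec_le_of_real (A.map (Int.cast : ℤ → ℝ))
    (by rwa [hcast])
  have hpow (n : ℕ) : (A ^ n).map (Int.cast : ℤ → ℝ) = A.map Int.cast ^ n :=
    map_pow (Int.castRingHom ℝ).mapMatrix A n
  refine ⟨C, hC, fun n v => ?_⟩
  simpa only [map_sub, map_one, LinearMap.sub_apply, Module.End.one_apply, lift_apply, hpow,
    sub_mulVec, one_mulVec] using h n v

theorem norm_intCast_comp (z : Fin d → ℤ) : ‖(Int.cast ∘ z : Fin d → ℝ)‖ = ‖z‖ :=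
  rfl

theorem one_le_norm_of_ne_zero {z : Fin d → ℤ} (hz : z ≠ 0) : 1 ≤ ‖z‖ := by
  obtain ⟨i, hi⟩ := Function.ne_iff.1 hz
  refine le_trans ?_ (norm_le_pi_norm z i)
  rw [Int.norm_eq_abs]
  exact_mod_cast Int.one_le_abs hi

namespace OrbitLengthBound

variable {A : Matrix (Fin d) (Fin d) ℤ} {C : ℝ}

theorem le_mul_norm_lift_intCast (h : OrbitLengthBound A C) (hA : A.det ≠ 0) (n : ℕ)
    {z : Fin d → ℤ} (hz : z ≠ 0) : n ≤ C * ‖lift (A ^ n - 1) (Int.cast ∘ z)‖ := by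
  have hpow (l : ℕ) : (A ^ l) *ᵥ z ≠ 0 := fun h0 =>
    hz (eq_zero_of_mulVec_eq_zero (by rw [det_pow]; exact pow_ne_zero l hA) h0)
  calc (n : ℝ) = ∑ l ∈ range n, 1 := by simp
    _ ≤ ∑ l ∈ range n, ‖lift (A ^ l) (Int.cast ∘ z)‖ := Finset.sum_le_sum fun l _ => by
        rw [lift_intCast, norm_intCast_comp]
        exact one_le_norm_of_ne_zero (hpow l)
    _ ≤ C * ‖lift (A ^ n - 1) (Int.cast ∘ z)‖ := h.sum_le n _

theorem det_pow_sub_one_ne_zero (h : OrbitLengthBound A C) (hA : A.det ≠ 0) {n : ℕ} (hn : n ≠ 0) :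
    (A ^ n - 1).det ≠ 0 := by
  intro hdet
  obtain ⟨z, hz, hz0⟩ := exists_mulVec_eq_zero_iff.2 hdet
  have hle := h.le_mul_norm_lift_intCast hA n hz
  have hzero : (Int.cast ∘ (0 : Fin d → ℤ) : Fin d → ℝ) = 0 := funext fun _ => Int.cast_zero
  rw [lift_intCast, hz0, hzero, norm_zero, mul_zero] at hle
  exact hn (Nat.le_zero.1 (by exact_mod_cast hle))

theorem sum_dist_proj_le (h : OrbitLengthBound A C) (n : ℕ) (v w : Fin d → ℝ) :
    ∑ l ∈ range n, dist ((toralMap A)^[l] (proj v)) ((toralMap A)^[l] (proj w)) ≤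
      C * ‖lift (A ^ n - 1) (v - w)‖ := by
  refine (Finset.sum_le_sum fun l _ => ?_).trans (h.sum_le n (v - w))
  rw [← toralMap_pow, toralMap_proj, toralMap_proj, map_sub]
  exact dist_proj_le _ _

end OrbitLengthBound

/-- The vector `m⁻¹ adj(N) z`. If `N.det = a * m` with `m ≠ 0`, it is `a N⁻¹ z`, so that its
projection to the torus is both killed by `toralMap N` and of `m`-torsion. -/
noncomputable def torsionVector (N : Matrix (Fin d) (Fin d) ℤ) (m : ℤ) (z : Fin d → ℤ) :
    Fin d → ℝ :=
  (m : ℝ)⁻¹ • (Int.cast ∘ (N.adjugate *ᵥ z))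

section torsionVector

variable {N : Matrix (Fin d) (Fin d) ℤ} {a m : ℤ}

theorem zsmul_proj_torsionVector (hm : m ≠ 0) (z : Fin d → ℤ) :
    m • proj (torsionVector N m z) = 0 := by
  rw [← map_zsmul, proj_eq_zero_iff]
  refine ⟨N.adjugate *ᵥ z, ?_⟩
  rw [torsionVector, ← Int.cast_smul_eq_zsmul ℝ, smul_inv_smul₀ (Int.cast_ne_zero.2 hm)]

theorem lift_torsionVector (hN : N.det = a * m) (hm : m ≠ 0) (z : Fin d → ℤ) :
    lift N (torsionVector N m z) = (a : ℝ) • (Int.cast ∘ z) := by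
  rw [torsionVector, map_smul, lift_intCast, mulVec_mulVec, mul_adjugate, hN, smul_mulVec,
    one_mulVec]
  ext i
  simp [field]

theorem toralMap_proj_torsionVector (hN : N.det = a * m) (hm : m ≠ 0) (z : Fin d → ℤ) :
    toralMap N (proj (torsionVector N m z)) = 0 := by
  rw [toralMap_proj, lift_torsionVector hN hm, proj_eq_zero_iff]
  exact ⟨a • z, by ext i; simp⟩

theorem norm_lift_torsionVector_sub_le (hN : N.det = a * m) (ha : a ≠ 0) (hm : m ≠ 0)
    (v : Fin d → ℝ) (e : Fin d → ℤ) :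
    ‖lift N (torsionVector N m ((fun i => ⌊(a : ℝ)⁻¹ * lift N v i⌋) + e) - v)‖ ≤
      |a| * (1 + ‖e‖) := by
  rw [map_sub, lift_torsionVector hN hm, pi_norm_le_iff_of_nonneg (by positivity)]
  intro i
  set t := (a : ℝ)⁻¹ * lift N v i
  have hround : |(⌊t⌋ : ℝ) - t| ≤ 1 := by
    rw [abs_sub_comm, Int.self_sub_floor, abs_of_nonneg (Int.fract_nonneg t)]
    exact (Int.fract_lt_one t).le
  have hv : lift N v i = a * t := (mul_inv_cancel_left₀ (Int.cast_ne_zero.2 ha) _).symm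
  have he : |(e i : ℝ)| ≤ ‖e‖ := Int.norm_eq_abs (e i) ▸ norm_le_pi_norm e i
  calc ‖(a : ℝ) * ((⌊t⌋ + e i : ℤ) : ℝ) - lift N v i‖
      = |(a : ℝ)| * |((⌊t⌋ : ℝ) - t) + e i| := by
        rw [hv, ← mul_sub, norm_mul, Real.norm_eq_abs, Real.norm_eq_abs, Int.cast_add,
          add_sub_right_comm]
    _ ≤ |(a : ℝ)| * (1 + ‖e‖) := by gcongr; exact (abs_add_le _ _).trans (add_le_add hround he)
    _ = |a| * (1 + ‖e‖) := by rw [Int.cast_abs]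

end torsionVector

theorem OrbitLengthBound.eq_of_proj_torsionVector_eq {A : Matrix (Fin d) (Fin d) ℤ} {C : ℝ}
    (h : OrbitLengthBound A C) (hA : A.det ≠ 0) {n : ℕ} {a m : ℤ}
    (hdet : (A ^ n - 1).det = a * m) (ha : a ≠ 0) (hm : m ≠ 0) {z z' : Fin d → ℤ}
    (hzz' : proj (torsionVector (A ^ n - 1) m z) = proj (torsionVector (A ^ n - 1) m z'))
    (hn : C * (|a| * ‖z - z'‖) < n) : z = z' := by
  rw [← sub_eq_zero, ← map_sub, proj_eq_zero_iff] at hzz'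
  obtain ⟨u, hu⟩ := hzz'
  have hlift : lift (A ^ n - 1) (Int.cast ∘ u) = (a : ℝ) • (Int.cast ∘ (z - z')) := by
    rw [hu, map_sub, lift_torsionVector hdet hm, lift_torsionVector hdet hm, ← smul_sub]
    ext i
    simp
  have hu0 : u = 0 := by
    by_contra hu0
    refine hn.not_ge ((h.le_mul_norm_lift_intCast hA n hu0).trans_eq ?_)
    rw [hlift, norm_smul, norm_intCast_comp, Real.norm_eq_abs, Int.cast_abs]
  ext i
  have hi := congrFun hlift i
  rw [lift_intCast, hu0, mulVec_zero] at hi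
  simpa [ha, sub_eq_zero, eq_comm] using hi

/-- The `k`-th point shadowing `x`: apply `N`, round to the lattice `a ℤ^d`, translate by
`a k` along the first coordinate, and apply `N⁻¹ = (a m)⁻¹ adj(N)`. -/
noncomputable def shadow [NeZero d] (N : Matrix (Fin d) (Fin d) ℤ) (a m : ℤ) (k : ℕ)
    (x : UnitAddTorus (Fin d)) : UnitAddTorus (Fin d) :=
  proj (torsionVector N m
    ((fun i => ⌊(a : ℝ)⁻¹ * lift N (fundamentalLift x) i⌋) + Pi.single 0 (k : ℤ)))

section shadow

variable [NeZero d] {a m : ℤ}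

theorem measurable_shadow (N : Matrix (Fin d) (Fin d) ℤ) (a m : ℤ) (k : ℕ) :
    Measurable (shadow N a m k) := by
  have hlift : Measurable (lift N) := (lift N).continuous_of_finiteDimensional.measurable
  have hfloor : Measurable fun x i => ⌊(a : ℝ)⁻¹ * lift N (fundamentalLift x) i⌋ :=
    measurable_pi_lambda _ fun i => Int.measurable_floor.comp <|
      ((measurable_pi_apply i).comp (hlift.comp measurable_fundamentalLift)).const_mul _
  have htranslate : Measurable fun z : Fin d → ℤ =>
      proj (torsionVector N m (z + Pi.single 0 (k : ℤ))) := .of_discrete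
  exact htranslate.comp hfloor

theorem zsmul_shadow (hm : m ≠ 0) (N : Matrix (Fin d) (Fin d) ℤ) (a : ℤ) (k : ℕ)
    (x : UnitAddTorus (Fin d)) : m • shadow N a m k x = 0 :=
  zsmul_proj_torsionVector hm _

variable {A : Matrix (Fin d) (Fin d) ℤ} {C : ℝ} {n : ℕ}

theorem iterate_toralMap_shadow (hdet : (A ^ n - 1).det = a * m) (hm : m ≠ 0) (k : ℕ)
    (x : UnitAddTorus (Fin d)) :
    (toralMap A)^[n] (shadow (A ^ n - 1) a m k x) = shadow (A ^ n - 1) a m k x := by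
  have hfix : toralMap (A ^ n - 1) (shadow (A ^ n - 1) a m k x) = 0 :=
    toralMap_proj_torsionVector hdet hm _
  rw [toralMap_sub_one, sub_eq_zero] at hfix
  rwa [← toralMap_pow]

namespace OrbitLengthBound

theorem sum_dist_shadow_le (h : OrbitLengthBound A C) (hdet : (A ^ n - 1).det = a * m)
    (ha : a ≠ 0) (hm : m ≠ 0) (k : ℕ) (x : UnitAddTorus (Fin d)) :
    ∑ l ∈ range n, dist ((toralMap A)^[l] (shadow (A ^ n - 1) a m k x)) ((toralMap A)^[l] x) ≤
      C * (|a| * (1 + k)) := by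
  have hsum := h.sum_dist_proj_le n (torsionVector (A ^ n - 1) m
    ((fun i => ⌊(a : ℝ)⁻¹ * lift (A ^ n - 1) (fundamentalLift x) i⌋) + Pi.single 0 (k : ℤ)))
    (fundamentalLift x)
  rw [proj_fundamentalLift] at hsum
  refine hsum.trans (mul_le_mul_of_nonneg_left ?_ h.nonneg)
  simpa [Pi.norm_single] using norm_lift_torsionVector_sub_le hdet ha hm (fundamentalLift x)
    (Pi.single 0 (k : ℤ))

theorem injective_shadow (h : OrbitLengthBound A C) (hA : A.det ≠ 0)
    (hdet : (A ^ n - 1).det = a * m) (ha : a ≠ 0) (hm : m ≠ 0) {K : ℕ} (hn : C * (|a| * K) < n)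
    (x : UnitAddTorus (Fin d)) :
    Function.Injective fun k : Fin K => shadow (A ^ n - 1) a m k x := by
  intro k k' hkk'
  have hdist : ‖((k : ℕ) : ℤ) - (k' : ℕ)‖ ≤ K := by
    rw [Int.norm_eq_abs, ← Int.cast_abs]
    exact_mod_cast abs_le.2 ⟨by lia, by lia⟩
  have hC := h.nonneg
  have heq := h.eq_of_proj_torsionVector_eq hA hdet ha hm hkk' <| by
    rw [add_sub_add_left_eq_sub, ← Pi.single_sub, Pi.norm_single]
    refine lt_of_le_of_lt ?_ hn
    gcongr
  simpa [Fin.ext_iff] using congrFun heq 0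

end OrbitLengthBound

end shadow

end Shadowing

section OrbitAverage

variable {X : Type*} [MeasurableSpace X] {T : X → X} {n : ℕ} {ν : Measure X}

/-- The average of the images of `ν` under the first `n` iterates of `T`, used to build invariant
measures. -/
noncomputable def orbitAverage (T : X → X) (n : ℕ) (ν : Measure X) : Measure X :=
  (n : ℝ≥0∞)⁻¹ • ∑ l ∈ range n, ν.map T^[l]

theorem isProbabilityMeasure_orbitAverage [IsProbabilityMeasure ν] (hT : Measurable T)
    (hn : n ≠ 0) : IsProbabilityMeasure (orbitAverage T n ν) := by
  constructor
  have hmass (l : ℕ) : ν.map T^[l] Set.univ = 1 := by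
    rw [Measure.map_apply (hT.iterate l) .univ, Set.preimage_univ, measure_univ]
  simp only [orbitAverage, Measure.smul_apply, Measure.finsetSum_apply, hmass, Finset.sum_const,
    Finset.card_range, nsmul_eq_mul, mul_one, smul_eq_mul]
  exact ENNReal.inv_mul_cancel (by simpa using hn) (ENNReal.natCast_ne_top n)

theorem map_orbitAverage (hT : Measurable T) (hν : ν.map T^[n] = ν) :
    (orbitAverage T n ν).map T = orbitAverage T n ν := by
  have hshift (l : ℕ) : (ν.map T^[l]).map T = ν.map T^[l + 1] := by
    rw [Measure.map_map hT (hT.iterate l), Function.iterate_succ']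
  have hsum : (∑ l ∈ range n, ν.map T^[l]).map T = ∑ l ∈ range n, ν.map T^[l] := by
    rw [← Measure.mapₗ_apply_of_measurable hT, map_sum]
    simp only [Measure.mapₗ_apply_of_measurable hT, hshift]
    obtain _ | n := n
    · rw [Finset.sum_range_zero, Finset.sum_range_zero]
    · rw [Finset.sum_range_succ, Finset.sum_range_succ', hν, Function.iterate_zero, Measure.map_id]
  rw [orbitAverage, Measure.map_smul, hsum]

theorem orbitAverage_eq_self (hT : Measurable T) (hν : ν.map T = ν) (hn : n ≠ 0) :
    orbitAverage T n ν = ν := by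
  have hiter (l : ℕ) : ν.map T^[l] = ν := (MeasurePreserving.iterate ⟨hT, hν⟩ l).map_eq
  simp only [orbitAverage, hiter, Finset.sum_const, Finset.card_range]
  rw [← Nat.cast_smul_eq_nsmul ℝ≥0∞, smul_smul,
    ENNReal.inv_mul_cancel (by simpa using hn) (ENNReal.natCast_ne_top n), one_smul]

theorem orbitAverage_singleton_le [MeasurableSingletonClass X] (hT : Measurable T)
    (hper : ∀ᵐ x ∂ν, T^[n] x = x) {ε : ℝ≥0∞} (hν : ∀ z, ν {z} ≤ ε) (z : X) :
    orbitAverage T n ν {z} ≤ ε := by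
  have hatom : ∀ l ∈ range n, ν.map T^[l] {z} ≤ ε := by
    intro l hl
    rw [Measure.map_apply (hT.iterate l) (measurableSet_singleton z)]
    refine (measure_mono_ae ?_).trans (hν (T^[n - l] z))
    filter_upwards [hper] with x hx (hz : T^[l] x = z)
    change x = T^[n - l] z
    rw [← hz, ← Function.iterate_add_apply, Nat.sub_add_cancel (Finset.mem_range.1 hl).le, hx]
  calc orbitAverage T n ν {z} = (n : ℝ≥0∞)⁻¹ * ∑ l ∈ range n, ν.map T^[l] {z} := by
        simp only [orbitAverage, Measure.smul_apply, Measure.finsetSum_apply, smul_eq_mul]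
    _ ≤ (n : ℝ≥0∞)⁻¹ * (n * ε) := by
        gcongr
        simpa using Finset.sum_le_sum hatom
    _ ≤ ε := by
        rw [← mul_assoc]
        exact mul_le_of_le_one_left' (ENNReal.inv_mul_le_one _)

theorem ae_orbitAverage_mem (hT : Measurable T) {s : Set X} (hs : MeasurableSet s)
    (hTs : Set.MapsTo T s s) (hν : ∀ᵐ x ∂ν, x ∈ s) : ∀ᵐ x ∂orbitAverage T n ν, x ∈ s := by
  refine Measure.ae_smul_measure (ae_finsetSum_measure_iff.2 fun l _ => ?_) _
  exact (ae_map_iff (hT.iterate l).aemeasurable hs).2 (hν.mono fun x hx => hTs.iterate l hx)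

section Integral

variable [IsFiniteMeasure ν]

theorem integrable_birkhoffAverage [TopologicalSpace X] [OpensMeasurableSpace X]
    (hT : Measurable T) (f : BoundedContinuousFunction X ℝ) :
    Integrable (birkhoffAverage ℝ T f n) ν :=
  (integrable_finsetSum _ fun l _ =>
    (f.integrable (ν.map T^[l])).comp_measurable (hT.iterate l)).smul (n : ℝ)⁻¹

theorem integral_orbitAverage [TopologicalSpace X] [OpensMeasurableSpace X]
    (hT : Measurable T) (f : BoundedContinuousFunction X ℝ) :
    ∫ x, f x ∂orbitAverage T n ν = ∫ x, birkhoffAverage ℝ T f n x ∂ν := by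
  have hint (l : ℕ) : Integrable f (ν.map T^[l]) := f.integrable _
  have hint_comp (l : ℕ) : Integrable (fun x => f (T^[l] x)) ν :=
    (hint l).comp_measurable (hT.iterate l)
  simp only [birkhoffAverage, birkhoffSum]
  rw [orbitAverage, integral_smul_measure, integral_finsetSum_measure fun l _ => hint l,
    ENNReal.toReal_inv, ENNReal.toReal_natCast, integral_smul,
    integral_finsetSum _ fun l _ => hint_comp l]
  congr 1
  exact Finset.sum_congr rfl fun l _ =>
    integral_map (hT.iterate l).aemeasurable (hint l).aestronglyMeasurable

end Integral

theorem abs_integral_orbitAverage_map_sub_le [PseudoMetricSpace X] [OpensMeasurableSpace X]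
    {Ω : Type*} [MeasurableSpace Ω] {P : Measure Ω} [IsProbabilityMeasure P] {Y Z : Ω → X}
    (hT : Measurable T) (hY : Measurable Y) (hZ : Measurable Z) {D : ℝ}
    (hD : ∀ ω, ∑ l ∈ range n, dist (T^[l] (Y ω)) (T^[l] (Z ω)) ≤ D)
    {f : BoundedContinuousFunction X ℝ} {c : ℝ≥0} (hf : LipschitzWith c f) :
    |∫ x, f x ∂orbitAverage T n (P.map Y) - ∫ x, f x ∂orbitAverage T n (P.map Z)| ≤
      c * D / n := by
  have hpoint (ω : Ω) :
      ‖birkhoffAverage ℝ T f n (Y ω) - birkhoffAverage ℝ T f n (Z ω)‖ ≤ c * D / n := by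
    rw [← dist_eq_norm]
    refine (dist_birkhoffAverage_birkhoffAverage_le ℝ T f n (Y ω) (Z ω)).trans ?_
    gcongr
    calc _ ≤ ∑ l ∈ range n, c * dist (T^[l] (Y ω)) (T^[l] (Z ω)) :=
          Finset.sum_le_sum fun l _ => hf.dist_le_mul _ _
      _ = c * ∑ l ∈ range n, dist (T^[l] (Y ω)) (T^[l] (Z ω)) := Finset.mul_sum _ _ _ |>.symm
      _ ≤ c * D := mul_le_mul_of_nonneg_left (hD ω) c.coe_nonneg
  have hint {W : Ω → X} (hW : Measurable W) :
      Integrable (fun ω => birkhoffAverage ℝ T f n (W ω)) P :=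
    (integrable_birkhoffAverage hT f).comp_measurable hW
  have hintegral {W : Ω → X} (hW : Measurable W) :
      ∫ x, f x ∂orbitAverage T n (P.map W) = ∫ ω, birkhoffAverage ℝ T f n (W ω) ∂P := by
    rw [integral_orbitAverage hT, integral_map hW.aemeasurable
      (integrable_birkhoffAverage hT f).aestronglyMeasurable]
  rw [hintegral hY, hintegral hZ, ← integral_sub (hint hY) (hint hZ), ← Real.norm_eq_abs]
  exact (norm_integral_le_of_norm_le_const (.of_forall hpoint)).trans_eq (by simp)

end OrbitAverage

theorem map_prod_singleton_le {X Y ι : Type*} [MeasurableSpace X] [MeasurableSpace Y]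
    [MeasurableSingletonClass Y] [MeasurableSpace ι] {μ : Measure X} [IsProbabilityMeasure μ]
    {κ : Measure ι} [SFinite κ] {ε : ℝ≥0∞} (hκ : ∀ k, κ {k} ≤ ε) {g : X × ι → Y}
    (hg : Measurable g) (hinj : ∀ x, Function.Injective fun k => g (x, k)) (y : Y) :
    (μ.prod κ).map g {y} ≤ ε := by
  have hfiber (x : X) : κ (Prod.mk x ⁻¹' (g ⁻¹' {y})) ≤ ε := by
    have hsub : (Prod.mk x ⁻¹' (g ⁻¹' {y})).Subsingleton := fun k hk k' hk' =>
      hinj x (hk.trans hk'.symm)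
    obtain h | ⟨k, h⟩ := hsub.eq_empty_or_singleton
    · simp only [h, measure_empty, zero_le]
    · simpa only [h] using hκ k
  rw [Measure.map_apply hg (measurableSet_singleton y),
    Measure.prod_apply (hg (measurableSet_singleton y))]
  exact (lintegral_mono hfiber).trans_eq (by simp)

theorem mem_closure_of_forall_lipschitz {X : Type*} [PseudoEMetricSpace X] [MeasurableSpace X]
    [OpensMeasurableSpace X] {S : Set (ProbabilityMeasure X)} {μ : ProbabilityMeasure X}
    (h : ∀ ε > 0, ∃ ν ∈ S, ∀ (f : BoundedContinuousFunction X ℝ) (c : ℝ≥0), LipschitzWith c f →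
      |∫ x, f x ∂(ν : Measure X) - ∫ x, f x ∂(μ : Measure X)| ≤ c * ε) : μ ∈ closure S := by
  choose ν hνS hν using fun n : ℕ => h (1 / (n + 1)) Nat.one_div_pos_of_nat
  refine mem_closure_of_tendsto (f := ν) (b := atTop) ?_ (.of_forall hνS)
  rw [tendsto_iff_forall_lipschitz_integral_tendsto]
  rintro f ⟨b, hb⟩ ⟨c, hf⟩
  refine tendsto_iff_dist_tendsto_zero.2 <| squeeze_zero (fun _ => dist_nonneg)
    (fun n => hν n (.mkOfBound ⟨f, hf.continuous⟩ b hb) c hf) ?_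
  simpa using tendsto_one_div_add_atTop_nhds_zero_nat.const_mul (c : ℝ)

section Density

variable {d : ℕ}

/-- The measure `ν` is carried by the `m`-torsion points of the torus for some `m` coprime to `q`.
Such measures are fixed by infinitely many powers of every matrix of determinant `q`. -/
def IsCoprimeTorsion (q : ℤ) (ν : ProbabilityMeasure (UnitAddTorus (Fin d))) : Prop :=
  ∃ m : ℤ, m ≠ 0 ∧ IsCoprime m q ∧ ∀ᵐ x ∂(ν : Measure (UnitAddTorus (Fin d))), m • x = 0

variable {A : Matrix (Fin d) (Fin d) ℤ}

theorem mem_invariantMeasures_iff {μ : ProbabilityMeasure (UnitAddTorus (Fin d))} :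
    μ ∈ invariantMeasures A ↔ (μ : Measure (UnitAddTorus (Fin d))).map (toralMap A) = μ :=
  Subtype.ext_iff

variable [NeZero d]

/-- The average over `k < K` of the images of `μ` under the shadow maps `shadow N a m k`, written as
the image of a product measure so that the shadows are coupled with the original points. -/
noncomputable def shadowMeasure (N : Matrix (Fin d) (Fin d) ℤ) (a m : ℤ) (K : ℕ)
    (μ : Measure (UnitAddTorus (Fin d))) : Measure (UnitAddTorus (Fin d)) :=
  (μ.prod (ProbabilityTheory.uniformOn (.univ : Set (Fin K)))).map fun ω => shadow N a m ω.2 ω.1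

section shadowMeasure

variable {N : Matrix (Fin d) (Fin d) ℤ} {a m : ℤ} {K : ℕ} {μ : Measure (UnitAddTorus (Fin d))}

theorem measurable_uncurry_shadow (N : Matrix (Fin d) (Fin d) ℤ) (a m : ℤ) (K : ℕ) :
    Measurable fun ω : UnitAddTorus (Fin d) × Fin K => shadow N a m ω.2 ω.1 :=
  measurable_from_prod_countable_left fun k => measurable_shadow N a m k

instance [NeZero K] [IsProbabilityMeasure μ] : IsProbabilityMeasure (shadowMeasure N a m K μ) :=
  Measure.isProbabilityMeasure_map (measurable_uncurry_shadow N a m K).aemeasurable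

theorem ae_shadowMeasure {p : UnitAddTorus (Fin d) → Prop} (hp : MeasurableSet {x | p x})
    (h : ∀ k x, p (shadow N a m k x)) : ∀ᵐ x ∂shadowMeasure N a m K μ, p x :=
  (ae_map_iff (measurable_uncurry_shadow N a m K).aemeasurable hp).2 (.of_forall fun _ => h _ _)

theorem shadowMeasure_singleton_le [IsProbabilityMeasure μ]
    (hinj : ∀ x, Function.Injective fun k : Fin K => shadow N a m k x)
    (z : UnitAddTorus (Fin d)) : shadowMeasure N a m K μ {z} ≤ (K : ℝ≥0∞)⁻¹ :=
  map_prod_singleton_le (fun _ => by simp [ProbabilityTheory.uniformOn_univ])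
    (measurable_uncurry_shadow N a m K) hinj z

end shadowMeasure

variable {C : ℝ}

theorem OrbitLengthBound.abs_integral_orbitAverage_shadowMeasure_sub_le
    (h : OrbitLengthBound A C) {n : ℕ} (hn : n ≠ 0) {a m : ℤ} (hdet : (A ^ n - 1).det = a * m)
    (ha : a ≠ 0) (hm : m ≠ 0) {K : ℕ} [NeZero K] {μ : ProbabilityMeasure (UnitAddTorus (Fin d))}
    (hμ : μ ∈ invariantMeasures A) {f : BoundedContinuousFunction (UnitAddTorus (Fin d)) ℝ}
    {c : ℝ≥0} (hf : LipschitzWith c f) :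
    |∫ x, f x ∂orbitAverage (toralMap A) n (shadowMeasure (A ^ n - 1) a m K μ) -
      ∫ x, f x ∂(μ : Measure (UnitAddTorus (Fin d)))| ≤ c * (C * (|a| * (1 + K))) / n := by
  have hT := (continuous_toralMap A).measurable
  have hsum (ω : UnitAddTorus (Fin d) × Fin K) : ∑ l ∈ range n,
      dist ((toralMap A)^[l] (shadow (A ^ n - 1) a m ω.2 ω.1)) ((toralMap A)^[l] ω.1) ≤
        C * (|a| * (1 + K)) := by
    refine (h.sum_dist_shadow_le hdet ha hm _ _).trans ?_
    have := h.nonneg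
    gcongr
    exact ω.2.is_lt.le
  have hbound := abs_integral_orbitAverage_map_sub_le
    (P := (μ : Measure (UnitAddTorus (Fin d))).prod (ProbabilityTheory.uniformOn .univ)) hT
    (measurable_uncurry_shadow (A ^ n - 1) a m K) measurable_fst hsum hf
  rwa [Measure.map_fst_prod, measure_univ, one_smul,
    orbitAverage_eq_self hT (mem_invariantMeasures_iff.1 hμ) hn] at hbound

theorem OrbitLengthBound.exists_isCoprimeTorsion (h : OrbitLengthBound A C)
    (hA : A.det ≠ 0) {n : ℕ} {a m q : ℤ} (hdet : (A ^ n - 1).det = a * m) (ha : a ≠ 0)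
    (hm : m ≠ 0) (hmq : IsCoprime m q) {K : ℕ} [NeZero K] (hn : C * (|a| * K) < n)
    {μ : ProbabilityMeasure (UnitAddTorus (Fin d))} (hμ : μ ∈ invariantMeasures A) :
    ∃ ν ∈ invariantMeasures A, (∀ x, (ν : Measure (UnitAddTorus (Fin d))) {x} ≤ (K : ℝ≥0∞)⁻¹) ∧
      IsCoprimeTorsion q ν ∧
      ∀ (f : BoundedContinuousFunction (UnitAddTorus (Fin d)) ℝ) (c : ℝ≥0), LipschitzWith c f →
        |∫ x, f x ∂(ν : Measure (UnitAddTorus (Fin d))) -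
          ∫ x, f x ∂(μ : Measure (UnitAddTorus (Fin d)))| ≤ c * (C * (|a| * (1 + K))) / n := by
  have hn0 : n ≠ 0 := by
    have hC := h.nonneg
    rintro rfl
    exact hn.not_ge (by rw [Nat.cast_zero]; positivity)
  have hT := (continuous_toralMap A).measurable
  have htorsion_closed : IsClosed {x : UnitAddTorus (Fin d) | m • x = 0} :=
    isClosed_eq (continuous_zsmul m) continuous_const
  have htorsion_mapsTo : Set.MapsTo (toralMap A) {x | m • x = 0} {x | m • x = 0} :=
    fun x (hx : m • x = 0) => show m • toralEnd A x = 0 by rw [← map_zsmul, hx, map_zero]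
  set ν := shadowMeasure (A ^ n - 1) a m K μ
  have hper : ∀ᵐ x ∂ν, (toralMap A)^[n] x = x :=
    ae_shadowMeasure (isClosed_eq ((continuous_toralMap A).iterate n) continuous_id).measurableSet
      fun k x => iterate_toralMap_shadow hdet hm k x
  have htor : ∀ᵐ x ∂ν, x ∈ {x : UnitAddTorus (Fin d) | m • x = 0} :=
    ae_shadowMeasure htorsion_closed.measurableSet fun k x => zsmul_shadow hm _ a k x
  have hinv : ν.map (toralMap A)^[n] = ν := (Measure.map_congr hper).trans Measure.map_id
  refine ⟨⟨_, isProbabilityMeasure_orbitAverage (ν := ν) hT hn0⟩,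
    mem_invariantMeasures_iff.2 (map_orbitAverage hT hinv),
    orbitAverage_singleton_le hT hper (shadowMeasure_singleton_le fun x =>
      h.injective_shadow hA hdet ha hm hn x),
    ⟨m, hm, hmq, ae_orbitAverage_mem hT htorsion_closed.measurableSet htorsion_mapsTo htor⟩,
    fun f c hf => h.abs_integral_orbitAverage_shadowMeasure_sub_le hn0 hdet ha hm hμ hf⟩

theorem invariantMeasures_subset_closure_isCoprimeTorsion (hA : A.det ≠ 0)
    (hspec : ∀ z ∈ spectrum ℂ (A.map (Int.cast : ℤ → ℂ)), ‖z‖ ≠ 1) {q : ℤ} (hq : q ≠ 0)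
    {ε : ℝ≥0∞} (hε : ε ≠ 0) :
    invariantMeasures A ⊆ closure {ν | ν ∈ invariantMeasures A ∧
      (∀ x, (ν : Measure (UnitAddTorus (Fin d))) {x} ≤ ε) ∧ IsCoprimeTorsion q ν} := by
  intro μ hμ
  obtain ⟨C, hC⟩ := exists_orbitLengthBound hspec
  have ha : (A - 1).det ≠ 0 := by simpa using hC.det_pow_sub_one_ne_zero hA one_ne_zero
  obtain ⟨K, hK⟩ := ENNReal.exists_inv_nat_lt hε
  have : NeZero K := ⟨by rintro rfl; simp at hK⟩
  refine mem_closure_of_forall_lipschitz fun δ hδ => ?_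
  have hlarge : ∀ᶠ n : ℕ in atTop, n ≠ 0 ∧ C * (|(A - 1).det| * K) < n ∧
      C * (|(A - 1).det| * (1 + K)) / n < δ :=
    (eventually_ne_atTop 0).and <| (tendsto_natCast_atTop_atTop.eventually_gt_atTop _).and <|
      (tendsto_natCast_atTop_atTop.const_div_atTop _).eventually_lt_const hδ
  obtain ⟨n, ⟨m, hmq, hdet⟩, hn0, hn, hnδ⟩ :=
    ((frequently_det_pow_sub_one_eq_mul ha hq).and_eventually hlarge).exists
  have hm : m ≠ 0 := by
    rintro rfl
    exact hC.det_pow_sub_one_ne_zero hA hn0 (by rw [hdet, mul_zero])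
  obtain ⟨ν, hνA, hν_atom, hν_tor, hν⟩ := hC.exists_isCoprimeTorsion hA hdet ha hm hmq hn hμ
  refine ⟨ν, ⟨hνA, fun x => (hν_atom x).trans hK.le, hν_tor⟩, fun f c hf => ?_⟩
  refine (hν f c hf).trans ?_
  rw [mul_div_assoc]
  gcongr

theorem dense_isCoprimeTorsion (hA : A.det ≠ 0)
    (hspec : ∀ z ∈ spectrum ℂ (A.map (Int.cast : ℤ → ℂ)), ‖z‖ ≠ 1) {q : ℤ} (hq : q ≠ 0)
    {ε : ℝ≥0∞} (hε : ε ≠ 0) :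
    Dense {ν : invariantMeasures A |
      (∀ x, (ν.1 : Measure (UnitAddTorus (Fin d))) {x} ≤ ε) ∧
      IsCoprimeTorsion q ν.1} := by
  rw [Subtype.dense_iff]
  refine (invariantMeasures_subset_closure_isCoprimeTorsion hA hspec hq hε).trans
    (closure_mono ?_)
  rintro ν ⟨hν, hν'⟩
  exact ⟨⟨ν, hν⟩, hν', rfl⟩

end Density

section Genericity

section Atoms

variable {X : Type*} [MeasurableSpace X]

theorem isOpen_setOf_measure_lt_of_isClosed [TopologicalSpace X] [OpensMeasurableSpace X]
    [HasOuterApproxClosed X] {F : Set X} (hF : IsClosed F) (ε : ℝ≥0∞) :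
    IsOpen {μ : ProbabilityMeasure X | (μ : Measure X) F < ε} :=
  isOpen_iff_mem_nhds.2 fun μ hμ => eventually_lt_of_limsup_lt <|
    (ProbabilityMeasure.limsup_measure_closed_le_of_tendsto (μs := id) tendsto_id hF).trans_lt hμ

theorem exists_measure_closedBall_lt [MetricSpace X] [OpensMeasurableSpace X] {μ : Measure X}
    [IsFiniteMeasure μ] {x : X} {ε : ℝ≥0∞} (hμ : μ {x} < ε) :
    ∃ r > 0, μ (Metric.closedBall x r) < ε := by
  have hlim := tendsto_measure_cthickening_of_isClosed (μ := μ) (s := {x})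
    ⟨1, one_pos, measure_ne_top _ _⟩ isClosed_singleton
  obtain ⟨r, hr, hr_pos⟩ := ((hlim.mono_left nhdsWithin_le_nhds).eventually_lt_const hμ |>.and
    (self_mem_nhdsWithin (s := Set.Ioi (0 : ℝ)))).exists
  exact ⟨r, hr_pos, by rwa [Metric.cthickening_singleton x (le_of_lt hr_pos)] at hr⟩

theorem isOpen_setOf_forall_measure_singleton_lt [MetricSpace X] [CompactSpace X]
    [OpensMeasurableSpace X] (ε : ℝ≥0∞) :
    IsOpen {μ : ProbabilityMeasure X | ∀ x, (μ : Measure X) {x} < ε} := by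
  rw [isOpen_iff_mem_nhds]
  intro μ hμ
  choose r hr hlt using fun x => exists_measure_closedBall_lt (hμ x)
  obtain ⟨t, -, ht⟩ := isCompact_univ.elim_nhds_subcover (fun x => Metric.closedBall x (r x))
    fun x _ => Metric.closedBall_mem_nhds x (hr x)
  have hnhds : ∀ x ∈ t, ∀ᶠ ν : ProbabilityMeasure X in 𝓝 μ,
      (ν : Measure X) (Metric.closedBall x (r x)) < ε := fun x _ =>
    (isOpen_setOf_measure_lt_of_isClosed Metric.isClosed_closedBall ε).mem_nhds (hlt x)
  filter_upwards [t.eventually_all.2 hnhds] with ν hν z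
  obtain ⟨x, hx, hz⟩ := Set.mem_iUnion₂.1 (ht (Set.mem_univ z))
  exact (measure_mono (Set.singleton_subset_iff.2 hz)).trans_lt (hν x hx)

theorem eventually_residual_nullSingletonClass [MetricSpace X] [CompactSpace X]
    [OpensMeasurableSpace X] {S : Set (ProbabilityMeasure X)}
    (hS : ∀ ε ≠ 0, Dense {μ : S | ∀ x, (μ.1 : Measure X) {x} ≤ ε}) :
    ∀ᶠ μ : S in residual S, NullSingletonClass (μ.1 : Measure X) := by
  have hsmall (k : ℕ) : ∀ᶠ μ : S in residual S, ∀ x, (μ.1 : Measure X) {x} < (k : ℝ≥0∞)⁻¹ := by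
    obtain ⟨ε, hε, hεk⟩ := exists_between (ENNReal.inv_pos.2 (ENNReal.natCast_ne_top k))
    exact residual_of_dense_open
      ((isOpen_setOf_forall_measure_singleton_lt _).preimage continuous_subtype_val)
      ((hS ε hε.ne').mono fun μ hμ x => (hμ x).trans_lt hεk)
  filter_upwards [eventually_countable_forall.2 hsmall] with μ hμ
  refine ⟨fun x => by_contra fun hx => ?_⟩
  obtain ⟨k, hk⟩ := ENNReal.exists_inv_nat_lt hx
  exact (hμ k x).not_gt hk

end Atoms

theorem eventually_residual_mapClusterPt {Z Y : Type*} [TopologicalSpace Z] [TopologicalSpace Y]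
    [TopologicalSpace.PseudoMetrizableSpace Y] {Φ : ℕ → Z → Y} {g : Z → Y}
    (hΦ : ∀ n, Continuous (Φ n)) (hg : Continuous g)
    (hdense : Dense {z | ∃ᶠ n in atTop, Φ n z = g z}) :
    ∀ᶠ z in residual Z, MapClusterPt (g z) atTop (Φ · z) := by
  let _ := TopologicalSpace.pseudoMetrizableSpacePseudoMetric Y
  have hclose (j : ℕ) : ∀ᶠ z in residual Z, ∃ n ≥ j, dist (Φ n z) (g z) < 1 / (j + 1) := by
    refine residual_of_dense_open ?_ (hdense.mono fun z hz => ?_)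
    · simp only [Set.ofPred_exists, Set.ofPred_and]
      exact isOpen_iUnion fun n =>
        isOpen_const.inter (isOpen_lt ((hΦ n).dist hg) continuous_const)
    · obtain ⟨n, hn, hz⟩ := frequently_atTop.1 hz j
      exact ⟨n, hn, by rw [hz, dist_self]; positivity⟩
  filter_upwards [eventually_countable_forall.2 hclose] with z hz
  choose n hn hdist using hz
  refine .of_comp (φ := n) (p := atTop) (tendsto_atTop_mono hn tendsto_id)
    (Tendsto.mapClusterPt ?_)
  exact tendsto_iff_dist_tendsto_zero.2 <| squeeze_zero (fun _ => dist_nonneg)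
    (fun j => (hdist j).le) tendsto_one_div_add_atTop_nhds_zero_nat

end Genericity

section Torsion

variable {d : ℕ} {ν : ProbabilityMeasure (UnitAddTorus (Fin d))} {q : ℤ}

theorem finite_setOf_zsmul_eq_zero {m : ℤ} (hm : m ≠ 0) :
    {x : UnitAddTorus (Fin d) | m • x = 0}.Finite := by
  have hcircle : {u : UnitAddCircle | m • u = 0}.Finite := by
    simpa only [natAbs_nsmul_eq_zero] using
      AddCircle.finite_torsion (1 : ℝ) (Int.natAbs_pos.2 hm)
  exact (Set.Finite.pi' fun _ : Fin d => hcircle).subset fun x hx i => congrFun hx i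

theorem IsCoprimeTorsion.ne_of_nullSingletonClass (hν : IsCoprimeTorsion q ν)
    {μ : ProbabilityMeasure (UnitAddTorus (Fin d))}
    [NullSingletonClass (μ : Measure (UnitAddTorus (Fin d)))] : ν ≠ μ := by
  rintro rfl
  obtain ⟨m, hm, -, hν⟩ := hν
  have hnull := (finite_setOf_zsmul_eq_zero hm).measure_zero (ν : Measure (UnitAddTorus (Fin d)))
  obtain ⟨x, hx, hx'⟩ := (hν.and (measure_eq_zero_iff_ae_notMem.1 hnull)).exists
  exact hx' hx

theorem pushforward_one_add_zsmul (D : Matrix (Fin d) (Fin d) ℤ) {m : ℤ}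
    (hν : ∀ᵐ x ∂(ν : Measure (UnitAddTorus (Fin d))), m • x = 0) :
    pushforward (1 + m • D) ν = ν := by
  refine Subtype.ext ((Measure.map_congr (g := id) ?_).trans Measure.map_id)
  filter_upwards [hν] with x hx
  calc toralMap (1 + m • D) x = x + toralEnd D (m • x) := by
        rw [← toralEnd_apply, map_add, map_one, map_zsmul, map_zsmul]
        rfl
    _ = x := by rw [hx, map_zero, add_zero]

theorem IsCoprimeTorsion.frequently_pushforward_pow_eq {B : Matrix (Fin d) (Fin d) ℤ}
    (hν : IsCoprimeTorsion B.det ν) : ∃ᶠ n in atTop, pushforward (B ^ n) ν = ν := by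
  obtain ⟨m, hm, hmB, hν⟩ := hν
  obtain ⟨r, hr, hpow⟩ := exists_pow_eq_one_add_zsmul hm hmB
  refine frequently_atTop.2 fun j => ⟨r * j, Nat.le_mul_of_pos_left j (Nat.pos_of_ne_zero hr), ?_⟩
  obtain ⟨D, hD⟩ := hpow j
  rw [hD, pushforward_one_add_zsmul D hν]

theorem nullSingletonClass_lebesgue [NeZero d] :
    NullSingletonClass (lebesgue d : Measure (UnitAddTorus (Fin d))) := by
  have : NullSingletonClass (volume : Measure UnitAddCircle) := ⟨fun x => by
    rw [← Metric.closedBall_zero, AddCircle.volume_closedBall]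
    simp⟩
  exact inferInstanceAs (NullSingletonClass (volume : Measure (UnitAddTorus (Fin d))))

end Torsion

end ToralDynamics

open ToralDynamics

theorem theorem3_general {d : ℕ} [NeZero d] {A B : Matrix (Fin d) (Fin d) ℤ}
    (hA : A.det ≠ 0) (hB : B.det ≠ 0)
    (hspec : ∀ z ∈ spectrum ℂ (A.map (Int.cast : ℤ → ℂ)), ‖z‖ ≠ 1) :
    {μ : ToralDynamics.invariantMeasures A |
        NullSingletonClass ((μ : ProbabilityMeasure (UnitAddTorus (Fin d))) :
          Measure (UnitAddTorus (Fin d))) ∧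
        ¬ Tendsto (fun n : ℕ => ToralDynamics.pushforward (B ^ n) (μ : ProbabilityMeasure _))
            atTop (𝓝 (ToralDynamics.lebesgue d))} ∈
      residual (ToralDynamics.invariantMeasures A) := by
  have hdense {ε : ENNReal} (hε : ε ≠ 0) := dense_isCoprimeTorsion hA hspec hB hε
  have hcont : ∀ᶠ μ : invariantMeasures A in residual _,
      NullSingletonClass (μ.1 : Measure (UnitAddTorus (Fin d))) :=
    eventually_residual_nullSingletonClass fun ε hε => (hdense hε).mono fun μ hμ => hμ.1
  have hne : ∀ᶠ μ : invariantMeasures A in residual _, μ.1 ≠ lebesgue d :=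
    have := nullSingletonClass_lebesgue (d := d)
    residual_of_dense_open (isOpen_ne.preimage continuous_subtype_val) <|
      (hdense one_ne_zero).mono fun μ hμ => hμ.2.ne_of_nullSingletonClass
  have hrec : ∀ᶠ μ : invariantMeasures A in residual _,
      MapClusterPt μ.1 atTop fun n => pushforward (B ^ n) μ.1 :=
    eventually_residual_mapClusterPt (fun n => (ProbabilityMeasure.continuous_map
      (continuous_toralMap (B ^ n))).comp continuous_subtype_val) continuous_subtype_val <|
      (hdense one_ne_zero).mono fun μ hμ => hμ.2.frequently_pushforward_pow_eq
  filter_upwards [hcont, hne, hrec] with μ hμ_cont hμ_ne hμ_rec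
  exact ⟨hμ_cont, fun hlim => hμ_ne (eq_of_nhds_neBot (hμ_rec.clusterPt.mono hlim))⟩

theorem theorem3 (d : ℕ) (hd : 2 ≤ d) (A B : Matrix (Fin d) (Fin d) ℤ)
    (hA : A.det ≠ 0) (hB : B.det ≠ 0)
    (hdiag : ∃ (P : Matrix.GeneralLinearGroup (Fin d) ℂ) (eig : Fin d → ℂ),
      (∀ j, ‖eig j‖ ≠ 1) ∧
      A.map (Int.cast : ℤ → ℂ) =
        (P : Matrix (Fin d) (Fin d) ℂ) * Matrix.diagonal eig *
          ((P⁻¹ : Matrix.GeneralLinearGroup (Fin d) ℂ) : Matrix (Fin d) (Fin d) ℂ))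
    (hAB : IsCoprime A.det B.det ∨
      ((∀ i j, j < i → A i j = 0) ∨ (∀ i j, i < j → A i j = 0))) :
    {μ : ToralDynamics.invariantMeasures A |
        NullSingletonClass ((μ : ProbabilityMeasure (UnitAddTorus (Fin d))) :
          Measure (UnitAddTorus (Fin d))) ∧
        ¬ Tendsto (fun n : ℕ => ToralDynamics.pushforward (B ^ n) (μ : ProbabilityMeasure _))
            atTop (𝓝 (ToralDynamics.lebesgue d))} ∈
      residual (ToralDynamics.invariantMeasures A) := by
  have : NeZero d := ⟨by omega⟩
  obtain ⟨P, eig, heig, hPA⟩ := hdiag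
  refine theorem3_general hA hB ?_
  rw [hPA, spectrum.units_conjugate, spectrum_diagonal]
  exact Set.forall_mem_range.2 heig
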